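/- Theorem (Zariski's Main Theorem à la Raynaud). Let $A \subseteq B$ be commutative rings with $B = A[x_1,\dots,x_n]$ for some $x_1,\dots,x_n \in B$. Suppose that the inclusion $A \to B$ is zero-dimensional, i.e. for every prime ideal $\mathfrak p$ of $A$ the prime ideals of $B$ lying over $\mathfrak p$ are pairwise incomparable for inclusion (in other words, $B$ is quasi-finite over $A$). Let $C$ be the integral closure of $A$ in $B$. Then there exist $m \ge 0$ and elements $s_1,\dots,s_m \in C$, comaximal in $B$ (that is, generating the unit ideal of $B$), such that $s_i x_j \in C$ for all $i$ and $j$. Moreover, for each $i$ the canonical map $C[1/s_i] \to B[1/s_i]$ is bijective, i.e. $C[1/s_i] = B[1/s_i]$; and the $A$-subalgebra $C' = A[(s_i)_i, (s_i x_j)_{i,j}]$ of $B$ is finite over $A$ (i.e. finitely generated as an $A$-module) and satisfies $C'[1/s_i] = B[1/s_i]$ for each $i$, in the same sense. -/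

import Mathlib

/-- A ring homomorphism `φ : A → B` is zero-dimensional when the prime ideals of `B` lying over
any given prime ideal of `A` are pairwise incomparable.  (An `A`-algebra is quasi-finite when it is
of finite type and its structure map is zero-dimensional.) -/
def IsZeroDimensionalHom {A B : Type*} [CommRing A] [CommRing B] (φ : A →+* B) : Prop :=
  ∀ P Q : Ideal B, P.IsPrime → Q.IsPrime → P.comap φ = Q.comap φ → P ≤ Q → P = Q

/-- The canonical ring homomorphism `D[1/s] → B[1/s]` for a subalgebra `D` of `B` and `s ∈ D`. -/
noncomputable def subalgebraAwayMap {A B : Type*} [CommRing A] [CommRing B] [Algebra A B]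
    (D : Subalgebra A B) (s : D) :
    Localization.Away s →+* Localization.Away (s : B) :=
  Localization.awayMap D.val.toRingHom s

/-- The subalgebra `A[(s_i), (s_i x_j)]` of `B`. -/
def adjoinMul {A B : Type*} [CommRing A] [CommRing B] [Algebra A B] {m n : ℕ}
    (s : Fin m → B) (x : Fin n → B) : Subalgebra A B :=
  Algebra.adjoin A (Set.range s ∪ Set.range fun p : Fin m × Fin n => s p.1 * x p.2)

theorem mem_adjoinMul {A B : Type*} [CommRing A] [CommRing B] [Algebra A B] {m n : ℕ}
    (s : Fin m → B) (x : Fin n → B) (i : Fin m) : s i ∈ adjoinMul (A := A) s x :=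
  Algebra.subset_adjoin (Or.inl ⟨i, rfl⟩)

/-! The core is the local form of Zariski's Main Theorem,
`Algebra.ZariskisMainProperty.of_finiteType`: at a maximal ideal `M` of `B` there is an integral `r
∉ M` such that each `b` has some `r ^ k * b` integral. A power of `r` then serves all the `x j`, so
the good multipliers lie in no common maximal ideal, and finitely many of them generate `1`. Once
`s` is inverted, `x j = (s * x j) / s` comes from the subalgebra. -/

/-- A zero-dimensional algebra of finite type is quasi-finite. -/
theorem IsZeroDimensionalHom.quasiFinite {A B : Type*} [CommRing A] [CommRing B] [Algebra A B]
    [Algebra.FiniteType A B] (h : IsZeroDimensionalHom (algebraMap A B)) :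
    Algebra.QuasiFinite A B := by
  refine ⟨fun p hp => ?_⟩
  -- The fibre is of finite type over a field; its primes are those of `B` over `p`, so
  -- incomparability makes them all maximal.
  rw [Module.finite_iff_krullDimLE_zero]
  refine .mk₀ fun I hI => ?_
  obtain ⟨M, hM, hIM⟩ := Ideal.exists_le_maximal I hI.ne_top
  let e := PrimeSpectrum.preimageOrderIsoFiber A B ⟨p, hp⟩
  let P := e.symm ⟨I, hI⟩
  let Q := e.symm ⟨M, hM.isPrime⟩
  have hPQ : P ≤ Q := e.symm.monotone hIM
  have heq : P = Q := by
    refine Subtype.ext (PrimeSpectrum.ext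
      (h _ _ P.1.isPrime Q.1.isPrime ?_ hPQ))
    exact congrArg PrimeSpectrum.asIdeal (P.2.trans Q.2.symm)
  have hIM' : I = M := congrArg PrimeSpectrum.asIdeal (e.symm.injective heq)
  exact hIM' ▸ hM

/-- If `s ∈ D` multiplies a generating set of `B` into the subalgebra `D`, then
`D[1/s] = B[1/s]`. -/
theorem subalgebraAwayMap_bijective {A B : Type*} [CommRing A] [CommRing B] [Algebra A B]
    {X : Set B} (hX : Algebra.adjoin A X = ⊤) (D : Subalgebra A B) (s : D)
    (hs : ∀ x ∈ X, (s : B) * x ∈ D) : Function.Bijective (subalgebraAwayMap D s) := by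
  refine ⟨Localization.awayMap_injective_iff.mpr fun a ha => ⟨0, ?_⟩,
    Localization.awayMap_surjective_iff.mpr fun b => ?_⟩
  · rw [pow_zero, one_mul]
    exact Subtype.ext ha
  suffices ∃ m : ℕ, (s : B) ^ m * b ∈ D by
    obtain ⟨m, hm⟩ := this
    exact ⟨⟨_, hm⟩, m, rfl⟩
  have hb : b ∈ Algebra.adjoin A X := hX ▸ Algebra.mem_top
  induction hb using Algebra.adjoin_induction with
  | mem x hx => exact ⟨1, by simpa using hs x hx⟩
  | algebraMap a => exact ⟨0, by simp⟩
  | add a b _ _ ha hb =>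
    obtain ⟨k, hk⟩ := ha
    obtain ⟨l, hl⟩ := hb
    refine ⟨k + l, ?_⟩
    convert! add_mem (mul_mem (pow_mem s.2 l) hk) (mul_mem (pow_mem s.2 k) hl) using 1
    ring
  | mul a b _ _ ha hb =>
    obtain ⟨k, hk⟩ := ha
    obtain ⟨l, hl⟩ := hb
    refine ⟨k + l, ?_⟩
    convert! mul_mem hk hl using 1
    ring

/-- In a quasi-finite algebra, the integral elements which multiply a given finite family into the
integral closure generate the unit ideal. -/
theorem span_integral_multipliers_eq_top {A B ι : Type*} [CommRing A] [CommRing B] [Algebra A B]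
    [Finite ι] [Algebra.FiniteType A B] [Algebra.QuasiFinite A B] (x : ι → B) :
    Ideal.span {s : B | s ∈ integralClosure A B ∧ ∀ j, s * x j ∈ integralClosure A B} = ⊤ := by
  have := Fintype.ofFinite ι
  by_contra hne
  obtain ⟨M, hM, hle⟩ := Ideal.exists_le_maximal _ hne
  obtain ⟨r, hrM, hr, H⟩ := Algebra.zariskisMainProperty_iff.mp
    (Algebra.ZariskisMainProperty.of_finiteType (R := A) M)
  choose k hk using fun j => H (x j)
  -- The sum of the `k j` is an exponent that works for every `j` at once.
  refine hrM (hM.isPrime.mem_of_pow_mem (∑ j, k j) (hle (Ideal.subset_span ⟨hr.pow _, fun j => ?_⟩)))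
  have hkj : k j ≤ ∑ j, k j := Finset.single_le_sum (fun _ _ => Nat.zero_le _) (Finset.mem_univ j)
  rw [← Nat.sub_add_cancel hkj, pow_add, mul_assoc]
  exact (hr.pow _).mul (hk j)

theorem mainTheorem6 {A B : Type*} [CommRing A] [CommRing B] [Algebra A B]
    (hAB : Function.Injective (algebraMap A B))
    (n : ℕ) (x : Fin n → B) (hx : Algebra.adjoin A (Set.range x) = ⊤)
    (hdim : IsZeroDimensionalHom (algebraMap A B)) :
    ∃ (m : ℕ) (s : Fin m → integralClosure A B),
      Ideal.span (Set.range fun i => (s i : B)) = ⊤ ∧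
      (∀ i j, (s i : B) * x j ∈ integralClosure A B) ∧
      (∀ i, Function.Bijective (subalgebraAwayMap (integralClosure A B) (s i))) ∧
      Module.Finite A (adjoinMul (A := A) (fun i => (s i : B)) x) ∧
      (∀ i, Function.Bijective
        (subalgebraAwayMap (adjoinMul (A := A) (fun i => (s i : B)) x)
          ⟨(s i : B), mem_adjoinMul (fun i => (s i : B)) x i⟩)) := by
  have : Algebra.FiniteType A B :=
    ⟨Subalgebra.fg_def.mpr ⟨Set.range x, Set.finite_range x, hx⟩⟩
  have : Algebra.QuasiFinite A B := hdim.quasiFinite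
  obtain ⟨T, hTS, hT⟩ := Submodule.mem_span_finite_of_mem_span
    ((Ideal.eq_top_iff_one _).mp (span_integral_multipliers_eq_top (A := A) x))
  let e := T.equivFin.symm
  let s : Fin T.card → integralClosure A B := fun i => ⟨e i, (hTS (e i).2).1⟩
  have hsx : ∀ i j, (s i : B) * x j ∈ integralClosure A B := fun i => (hTS (e i).2).2
  refine ⟨T.card, s, ?_, hsx, fun i => ?_, ?_, fun i => ?_⟩
  · have hrange : Set.range (fun i => (s i : B)) = (T : Set B) := by
      change Set.range (Subtype.val ∘ e) = _
      rw [e.surjective.range_comp, Subtype.range_coe_subtype]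
      rfl
    rw [hrange]
    exact (Ideal.eq_top_iff_one _).mpr hT
  · exact subalgebraAwayMap_bijective hx _ _ (Set.forall_mem_range.mpr (hsx i))
  -- Finitely many integral generators give a finite module.
  · refine ⟨(Submodule.fg_top _).mpr (fg_adjoin_of_finite
      ((Set.finite_range _).union (Set.finite_range _)) ?_)⟩
    rintro _ (⟨i, rfl⟩ | ⟨p, rfl⟩)
    exacts [(s i).2, hsx p.1 p.2]
  · exact subalgebraAwayMap_bijective hx _ _ (Set.forall_mem_range.mpr fun j =>
      Algebra.subset_adjoin (Or.inr ⟨(i, j), rfl⟩))
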